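/- **Proposition 2 (Optimal resource allocation).** Let $\mathcal N,\mathcal K,\mathcal T_i$ be the finite sets of base stations, resource blocks (RBs) and time slots of a communication interval. Let $\delta^2>0$ be the noise power and, for $n\in\mathcal N,k\in\mathcal K,t\in\mathcal T_i$, let $g_n[k,t]>0$ be the large-scale gain and $\kappa_n[k,t]>0$ the Gamma fading shape; put $\beta_n[k,t]=e^{\psi(\kappa_n[k,t])}/\kappa_n[k,t]$ with the digamma function $\psi=\Gamma'/\Gamma$, and $\iota_n[k,t]=\delta^2/(\beta_n[k,t]\,g_n[k,t])$. Let $\bar p>0$, $\bar\upsilon>0$ and let $\varepsilon_\theta\ge 1$ be an integer. Let $\mathcal A(t)$ be the set of all $\{a_n[k,t]\}_{n,k}$ with $a_n[k,t]\in[0,1]$, $\sum_k a_n[k,t]\le\varepsilon_\theta$ for all $n$, and $\sum_n a_n[k,t]\le 1$ for all $k$. Let $\mathscr P4$ be the problem $$\min_{a,\phi}\ \sum_{n,k,t}\iota_n[k,t]\,a_n[k,t]\bigl(2^{\phi_n[k,t]/a_n[k,t]}-1\bigr)$$ subject to $\sum_{n,k,t}\phi_n[k,t]\ge\bar\upsilon$,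 $\phi_n[k,t]\ge 0$, $\sum_{n,k}\iota_n[k,t]a_n[k,t](2^{\phi_n[k,t]/a_n[k,t]}-1)\le\bar p$ for each $t$, and $\{a_n[k,t]\}_{n,k}\in\mathcal A(t)$ for each $t$; here $a_n[k,t]=0$ forces $\phi_n[k,t]=0$, and the corresponding energy term is then $0$. Assume that $\mathscr P4$ is feasible. For $\lambda>0$ put $p_n[k,t;\lambda]=[\lambda-\iota_n[k,t]]^+$, $\bar c_n[k,t;\lambda]=[\log_2\lambda-\log_2\iota_n[k,t]]^+$ with $[x]^+=\max(0,x)$, let $w_n[k,t;\lambda]=p_n[k,t;\lambda]-\ln 2\cdot\lambda\,\bar c_n[k,t;\lambda]$, and let $\mathcal A^*(t;\lambda)$ be the set of minimizers of the linear program $\min_{A\in\mathcal A(t)}\sum_{n,k}w_n[k,t;\lambda]\,a_n[k,t]$. Then there are an optimal solution $(a,\phi)$ of $\mathscr P4$, a global level $\lambda^*>0$ and per-slot caps $\tilde\lambda_t>0$ such that, with the effective water levels $\lambda_t=\min\{\lambda^*/\ln 2,\ \tilde\lambda_t\}$: 1. for each $t$, $\{a_n[k,t]\}_{n,k}\in\mathcal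 A^*(t;\lambda_t)$; 2. $\phi_n[k,t]=a_n[k,t]\,\bar c_n[k,t;\lambda_t]$ for all $n,k,t$, and the transmit power $\iota_n[k,t](2^{\phi_n[k,t]/a_n[k,t]}-1)$ equals $p_n[k,t;\lambda_t]$ wherever $a_n[k,t]>0$; 3. for each $t$ the cap satisfies $\sum_{n,k}\tilde a_n[k,t]\,[\tilde\lambda_t-\iota_n[k,t]]^+=\bar p$ for some $\{\tilde a_n[k,t]\}_{n,k}\in\mathcal A^*(t;\tilde\lambda_t)$, which is equal to $\{a_n[k,t]\}_{n,k}$ if $\tilde\lambda_t<\lambda^*/\ln 2$; 4. $\sum_{n,k,t}a_n[k,t]\,\bar c_n[k,t;\lambda_t]=\bar\upsilon$. -/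

import Mathlib

/-! Resource allocation over one communication interval.  `N` is the finite set of base stations,
`K` the finite set of resource blocks, `T` the finite set of time slots of the interval.  Data and
decisions are families indexed by slot, then base station, then resource block. -/

noncomputable section

namespace RBAlloc

/-- The digamma function `ψ = Γ' / Γ` on the reals (it is real there). -/
def digamma (x : ℝ) : ℝ := (Complex.digamma (x : ℂ)).re

/-- The fading loss `β = exp (ψ κ) / κ` of a unit-mean Gamma fading with shape `κ`. -/
def fadingLoss (κ : ℝ) : ℝ := Real.exp (digamma κ) / κ

/-- The water-filling floor `ι = δ² / (β g)`; `δsq` is the noise power `δ²`, `g` the large-scale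
channel gain. -/
def iota (δsq g κ : ℝ) : ℝ := δsq / (fadingLoss κ * g)

/-- The transmit power belonging to the transformed variables `(a, φ)`. -/
def txPower (ι a φ : ℝ) : ℝ :=
  if 0 < a then ι * ((2 : ℝ) ^ (φ / a) - 1) else 0

/-- The energy term `ι a (2 ^ (φ / a) - 1)`, a perspective function.  At `a = 0` it evaluates to
`0`; its domain there is `φ = 0`, which is imposed in `Feasible.dom`. -/
def energyTerm (ι a φ : ℝ) : ℝ := ι * a * ((2 : ℝ) ^ (φ / a) - 1)

variable {N K T : Type*} [Fintype N] [Fintype K] [Fintype T]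

/-- The per-slot polytope `𝒜(t)` of relaxed resource block allocations. -/
structure RBFeasible (ε : ℕ) (A : N → K → ℝ) : Prop where
  load : ∀ n, ∑ k, A n k ≤ (ε : ℝ)
  single : ∀ k, ∑ n, A n k ≤ 1
  mem_Icc : ∀ n k, A n k ∈ Set.Icc (0 : ℝ) 1

/-- The constraints of the relaxed convex problem, with floors `ι`, power budget `pbar`, rate
requirement `υbar` and load cap `ε`. -/
structure Feasible (ι : T → N → K → ℝ) (pbar υbar : ℝ) (ε : ℕ) (a φ : T → N → K → ℝ) : Prop where
  rate : υbar ≤ ∑ t, ∑ n, ∑ k, φ t n k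
  nonneg : ∀ t n k, 0 ≤ φ t n k
  power : ∀ t, ∑ n, ∑ k, energyTerm (ι t n k) (a t n k) (φ t n k) ≤ pbar
  alloc : ∀ t, RBFeasible ε (a t)
  /-- `φ = c̄ a` vanishes with `a`: the domain of the perspective function. -/
  dom : ∀ t n k, a t n k = 0 → φ t n k = 0

/-- The objective of the relaxed convex problem. -/
def energy (ι a φ : T → N → K → ℝ) : ℝ :=
  ∑ t, ∑ n, ∑ k, energyTerm (ι t n k) (a t n k) (φ t n k)

/-- `(a, φ)` is an optimal solution of the relaxed convex problem. -/
def IsOptimal (ι : T → N → K → ℝ) (pbar υbar : ℝ) (ε : ℕ) (a φ : T → N → K → ℝ) : Prop :=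
  Feasible ι pbar υbar ε a φ ∧
    ∀ a' φ' : T → N → K → ℝ, Feasible ι pbar υbar ε a' φ' → energy ι a φ ≤ energy ι a' φ'

/-- The water-filling power `[l - ι]⁺` at water level `l`. -/
def wfPower (ι l : ℝ) : ℝ := max 0 (l - ι)

/-- The water-filling rate `[log₂ l - log₂ ι]⁺` at water level `l`. -/
def wfRate (ι l : ℝ) : ℝ := max 0 (Real.logb 2 l - Real.logb 2 ι)

/-- The weight `w = p - ln 2 · l · c̄` of the per-slot linear program at water level `l`. -/
def weight (ι l : ℝ) : ℝ := wfPower ι l - Real.log 2 * l * wfRate ι l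

/-- The set `𝒜*(t; l)` of optimal solutions of the per-slot linear program at water level `l`;
`ι` holds the floors of the slot. -/
def lpArgmin (ι : N → K → ℝ) (ε : ℕ) (l : ℝ) : Set (N → K → ℝ) :=
  {A | RBFeasible ε A ∧ ∀ B : N → K → ℝ, RBFeasible ε B →
    ∑ n, ∑ k, weight (ι n k) l * A n k ≤ ∑ n, ∑ k, weight (ι n k) l * B n k}

/-- The sum power of a slot at water level `l` under the allocation `A`. -/
def slotPower (ι A : N → K → ℝ) (l : ℝ) : ℝ := ∑ n, ∑ k, A n k * wfPower (ι n k) l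

/-- The sum rate of a slot at water level `l` under the allocation `A`. -/
def slotRate (ι A : N → K → ℝ) (l : ℝ) : ℝ := ∑ n, ∑ k, A n k * wfRate (ι n k) l

/-- The effective water level `min {lstar / ln 2, cap}`. -/
def level (lstar cap : ℝ) : ℝ := min (lstar / Real.log 2) cap

end RBAlloc

end

/-! The proof is Lagrangian duality plus a connectedness argument. When a rate unit is priced at `ln
2 · l`, a resource block costs least at the water-filling rate, and that least cost is `weight`
(`weight_le`). By perspective scaling, the Lagrangian of a slot is then minimized by the minimizers
of a linear program (`lagrangian_le`).

Linear program minimizers jump as `l` varies, so no continuous choice of allocation is available.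
The pairs of level and minimizer do form a closed graph with compact convex fibres, and intermediate
values survive for such graphs (`exists_mem_graph_eq`). This is applied to the power of each slot,
giving the caps, and then to the total rate, giving the global level. Weak duality shows the
resulting point optimal; a slot above its cap spends its whole budget, so it already has the largest
possible rate. -/

namespace RBAlloc

/-! ### Intermediate values of set-valued maps -/

/-- An intermediate value theorem for correspondences with closed graph in a compact set and convex
nonempty fibres. -/
theorem exists_mem_graph_eq {E : Type*} [TopologicalSpace E] [AddCommGroup E] [Module ℝ E]
    [ContinuousAdd E] [ContinuousSMul ℝ E] {G : Set (ℝ × E)} (hG : IsClosed G) {C : Set E}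
    (hC : IsCompact C) (hGC : ∀ s x, (s, x) ∈ G → x ∈ C)
    (hconv : ∀ s, Convex ℝ {x | (s, x) ∈ G}) {lo hi : ℝ} (hlh : lo ≤ hi)
    (hne : ∀ s ∈ Set.Icc lo hi, ∃ x, (s, x) ∈ G) {h : ℝ × E → ℝ} (hh : Continuous h) (y : ℝ)
    (hlo : ∃ x, (lo, x) ∈ G ∧ h (lo, x) ≤ y) (hhi : ∃ x, (hi, x) ∈ G ∧ y ≤ h (hi, x)) :
    ∃ s ∈ Set.Icc lo hi, ∃ x, (s, x) ∈ G ∧ h (s, x) = y := by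
  -- Projection along a compact factor is a closed map.
  have closed_proj : ∀ S : Set (ℝ × E), IsClosed S →
      IsClosed {s | ∃ x ∈ C, (s, x) ∈ S} := by
    intro S hS
    have hcompact := isCompact_iff_compactSpace.mp hC
    have hcl : IsClosed {q : ℝ × C | (q.1, (q.2 : E)) ∈ S} :=
      hS.preimage (by fun_prop)
    have := isClosedMap_fst_of_compactSpace (X := ℝ) (Y := C) _ hcl
    convert this using 1
    ext s
    simp only [Set.mem_ofPred_eq, Set.mem_image, Prod.exists, Subtype.exists]
    constructor
    · rintro ⟨x, hx, hs⟩
      exact ⟨s, x, hx, hs, rfl⟩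
    · rintro ⟨_, x, hx, hs, rfl⟩
      exact ⟨x, hx, hs⟩
  have hpre : IsPreconnected (Set.Icc lo hi) := isPreconnected_Icc
  rw [isPreconnected_closed_iff] at hpre
  obtain ⟨xlo, hxlo, hxlo'⟩ := hlo
  obtain ⟨xhi, hxhi, hxhi'⟩ := hhi
  -- The parameters attaining a value at most `y` and those attaining one at least `y` are closed
  -- and cover the interval, so some `s` has both; its convex fibre then attains `y`.
  obtain ⟨s, hs, ⟨x₁, -, hx₁, hy₁⟩, ⟨x₂, -, hx₂, hy₂⟩⟩ := hpre
    {s | ∃ x ∈ C, (s, x) ∈ G ∩ {q | h q ≤ y}} {s | ∃ x ∈ C, (s, x) ∈ G ∩ {q | y ≤ h q}}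
    (closed_proj _ (hG.inter (isClosed_le hh continuous_const)))
    (closed_proj _ (hG.inter (isClosed_le continuous_const hh)))
    (fun s hs => by
      obtain ⟨x, hx⟩ := hne s hs
      rcases le_total (h (s, x)) y with hy | hy
      · exact Or.inl ⟨x, hGC _ _ hx, hx, hy⟩
      · exact Or.inr ⟨x, hGC _ _ hx, hx, hy⟩)
    ⟨lo, Set.left_mem_Icc.2 hlh, xlo, hGC _ _ hxlo, hxlo, hxlo'⟩
    ⟨hi, Set.right_mem_Icc.2 hlh, xhi, hGC _ _ hxhi, hxhi, hxhi'⟩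
  have hcont : ContinuousOn (fun x => h (s, x)) {x | (s, x) ∈ G} :=
    (hh.comp (by fun_prop)).continuousOn
  obtain ⟨x, hx, hxy⟩ := (hconv s).isPreconnected.intermediate_value hx₁ hx₂ hcont ⟨hy₁, hy₂⟩
  exact ⟨s, hs, x, hx, hxy⟩

/-! ### Water-filling on one resource block -/

theorem iota_pos {δsq g κ : ℝ} (hδ : 0 < δsq) (hg : 0 < g) (hκ : 0 < κ) : 0 < iota δsq g κ := by
  unfold iota fadingLoss
  positivity

theorem wfRate_nonneg (ι l : ℝ) : 0 ≤ wfRate ι l := le_max_left _ _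

theorem wfRate_of_le {ι l : ℝ} (hl : 0 < l) (h : l ≤ ι) : wfRate ι l = 0 :=
  max_eq_left (sub_nonpos.2 (Real.logb_le_logb_of_le one_lt_two hl h))

theorem wfPower_of_le {ι l : ℝ} (h : l ≤ ι) : wfPower ι l = 0 :=
  max_eq_left (sub_nonpos.2 h)

theorem wfRate_of_ge {ι l : ℝ} (hι : 0 < ι) (h : ι ≤ l) :
    wfRate ι l = Real.logb 2 (l / ι) := by
  rw [Real.logb_div (hι.trans_le h).ne' hι.ne']
  exact max_eq_right (sub_nonneg.2 (Real.logb_le_logb_of_le one_lt_two hι h))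

theorem wfPower_of_ge {ι l : ℝ} (h : ι ≤ l) : wfPower ι l = l - ι :=
  max_eq_right (sub_nonneg.2 h)

theorem mul_two_rpow_wfRate_sub_one {ι l : ℝ} (hι : 0 < ι) (hl : 0 < l) :
    ι * ((2 : ℝ) ^ wfRate ι l - 1) = wfPower ι l := by
  rcases le_total l ι with h | h
  · simp [wfRate_of_le hl h, wfPower_of_le h]
  · rw [wfRate_of_ge hι h, wfPower_of_ge h,
      Real.rpow_logb two_pos (by norm_num) (div_pos hl hι)]
    field_simp

theorem energyTerm_wfRate {ι l : ℝ} (hι : 0 < ι) (hl : 0 < l) (a : ℝ) :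
    energyTerm ι a (a * wfRate ι l) = a * wfPower ι l := by
  unfold energyTerm
  rcases eq_or_ne a 0 with rfl | ha
  · simp
  · rw [mul_div_cancel_left₀ _ ha, ← mul_two_rpow_wfRate_sub_one hι hl]
    ring

/-- The weight is negative above the floor. -/
theorem weight_neg {ι l : ℝ} (hι : 0 < ι) (h : ι < l) : weight ι l < 0 := by
  have hl := hι.trans h
  have hlog : Real.log (ι / l) < ι / l - 1 :=
    Real.log_lt_sub_one_of_pos (div_pos hι hl) ((div_lt_one hl).2 h).ne
  rw [Real.log_div hι.ne' hl.ne'] at hlog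
  have h2 : Real.log 2 ≠ 0 := (Real.log_pos one_lt_two).ne'
  have hmul := mul_lt_mul_of_pos_left hlog hl
  have hcancel : l * (ι / l - 1) = ι - l := by field_simp
  have hrate : Real.log 2 * l * wfRate ι l = l * (Real.log l - Real.log ι) := by
    rw [wfRate_of_ge hι h.le, Real.logb, Real.log_div hl.ne' hι.ne']
    field_simp
  rw [weight, hrate, wfPower_of_ge h.le]
  linarith

/-- The weight is the minimal Lagrangian cost of a resource block. -/
theorem weight_le {ι l x : ℝ} (hι : 0 < ι) (hl : 0 < l) (hx : 0 ≤ x) :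
    weight ι l ≤ ι * ((2 : ℝ) ^ x - 1) - Real.log 2 * l * x := by
  have h2 : 0 < Real.log 2 := Real.log_pos one_lt_two
  rcases le_total l ι with h | h
  · rw [weight, wfRate_of_le hl h, wfPower_of_le h]
    -- Below the floor the minimizer is `0`: tangent line of `2 ^ x` at `0`.
    have hexp : Real.log 2 * x + 1 ≤ (2 : ℝ) ^ x := by
      rw [Real.rpow_def_of_pos two_pos]
      exact Real.add_one_le_exp _
    have h1 : ι * (Real.log 2 * x) ≤ ι * ((2 : ℝ) ^ x - 1) :=
      mul_le_mul_of_nonneg_left (by linarith) hι.le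
    have h3 : l * (Real.log 2 * x) ≤ ι * (Real.log 2 * x) :=
      mul_le_mul_of_nonneg_right h (by positivity)
    linarith
  · set r := wfRate ι l with hr
    -- Stationarity at `r`; convexity then enters as the tangent line at `r`.
    have hpow : ι * (2 : ℝ) ^ r = l := by
      have := mul_two_rpow_wfRate_sub_one hι hl
      rw [wfPower_of_ge h] at this
      linarith
    have hexp : Real.log 2 * (x - r) + 1 ≤ (2 : ℝ) ^ (x - r) := by
      rw [Real.rpow_def_of_pos two_pos]
      exact Real.add_one_le_exp _
    have hsplit : ι * (2 : ℝ) ^ x = l * (2 : ℝ) ^ (x - r) := by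
      rw [← hpow, mul_assoc, ← Real.rpow_add two_pos]
      ring_nf
    have hm := mul_le_mul_of_nonneg_left hexp hl.le
    rw [weight, wfPower_of_ge h, mul_sub, hsplit]
    linarith

/-- This is `weight_le` at `x = φ / a`, scaled by `a`. At `a = 0` it would fail for `φ > 0`, which
`hdom` excludes. -/
theorem mul_weight_le {ι l a φ : ℝ} (hι : 0 < ι) (hl : 0 < l) (ha : 0 ≤ a) (hφ : 0 ≤ φ)
    (hdom : a = 0 → φ = 0) :
    weight ι l * a ≤ energyTerm ι a φ - Real.log 2 * l * φ := by
  rcases ha.eq_or_lt with rfl | ha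
  · simp [energyTerm, hdom rfl]
  · have h := mul_le_mul_of_nonneg_right (weight_le hι hl (div_nonneg hφ ha.le)) ha.le
    have : Real.log 2 * l * (φ / a) * a = Real.log 2 * l * φ := by field_simp
    rw [sub_mul, this] at h
    unfold energyTerm
    linarith

/-! ### The Lagrangian of one slot -/

variable {N K T : Type*} [Fintype N] [Fintype K]

theorem sum_weight_mul (ι A : N → K → ℝ) (l : ℝ) :
    ∑ n, ∑ k, weight (ι n k) l * A n k = slotPower ι A l - Real.log 2 * l * slotRate ι A l := by
  simp only [slotPower, slotRate, Finset.mul_sum, ← Finset.sum_sub_distrib]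
  refine Finset.sum_congr rfl fun n _ => Finset.sum_congr rfl fun k _ => ?_
  unfold weight
  ring

/-- A solution of the linear program at level `l` minimizes the Lagrangian of the slot. -/
theorem lagrangian_le {ι : N → K → ℝ} (hι : ∀ n k, 0 < ι n k) {ε : ℕ} {l : ℝ} (hl : 0 < l)
    {A : N → K → ℝ} (hA : A ∈ lpArgmin ι ε l) {B φ : N → K → ℝ} (hB : RBFeasible ε B)
    (hφ : ∀ n k, 0 ≤ φ n k) (hdom : ∀ n k, B n k = 0 → φ n k = 0) :
    slotPower ι A l - Real.log 2 * l * slotRate ι A l ≤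
      ∑ n, ∑ k, energyTerm (ι n k) (B n k) (φ n k) - Real.log 2 * l * ∑ n, ∑ k, φ n k := by
  rw [← sum_weight_mul]
  refine (hA.2 B hB).trans ?_
  simp only [Finset.mul_sum, ← Finset.sum_sub_distrib]
  exact Finset.sum_le_sum fun n _ => Finset.sum_le_sum fun k _ =>
    mul_weight_le (hι n k) hl (hB.mem_Icc n k).1 (hφ n k) (hdom n k)

theorem sum_energyTerm_wfRate {ι : N → K → ℝ} (hι : ∀ n k, 0 < ι n k) {l : ℝ} (hl : 0 < l)
    (A : N → K → ℝ) :
    ∑ n, ∑ k, energyTerm (ι n k) (A n k) (A n k * wfRate (ι n k) l) = slotPower ι A l :=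
  Finset.sum_congr rfl fun n _ => Finset.sum_congr rfl fun k _ => energyTerm_wfRate (hι n k) hl _

/-- The power of a slot is monotone in the water level. -/
theorem slotPower_mono {ι : N → K → ℝ} (hι : ∀ n k, 0 < ι n k) {ε : ℕ} {l l' : ℝ} (hl : 0 < l)
    (hll : l < l') {A A' : N → K → ℝ} (hA : A ∈ lpArgmin ι ε l) (hA' : A' ∈ lpArgmin ι ε l') :
    slotPower ι A l ≤ slotPower ι A' l' := by
  have hl' := hl.trans hll
  have h2 : 0 < Real.log 2 := Real.log_pos one_lt_two
  have key : ∀ {l l' : ℝ} {A A' : N → K → ℝ}, 0 < l → 0 < l' → A ∈ lpArgmin ι ε l →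
      A' ∈ lpArgmin ι ε l' → slotPower ι A l - Real.log 2 * l * slotRate ι A l ≤
        slotPower ι A' l' - Real.log 2 * l * slotRate ι A' l' := by
    intro l l' A A' hl hl' hA hA'
    have h := lagrangian_le hι hl hA hA'.1
      (φ := fun n k => A' n k * wfRate (ι n k) l')
      (fun n k => mul_nonneg (hA'.1.mem_Icc n k).1 (wfRate_nonneg _ _))
      (fun n k h => by simp [h])
    rwa [sum_energyTerm_wfRate hι hl'] at h
  -- Exchange argument: adding the two optimality inequalities orders the rates, and `h₁` then
  -- orders the powers.
  have h₁ := key hl hl' hA hA'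
  have h₂ := key hl' hl hA' hA
  have hR : slotRate ι A l ≤ slotRate ι A' l' := by
    have : 0 ≤ Real.log 2 * (l' - l) * (slotRate ι A' l' - slotRate ι A l) := by linarith
    have := nonneg_of_mul_nonneg_right this (mul_pos h2 (sub_pos.2 hll))
    linarith
  have := mul_le_mul_of_nonneg_left hR (mul_pos h2 hl).le
  linarith

/-- A solution of the linear program which spends the whole budget has maximal rate. -/
theorem rate_le_slotRate {ι : N → K → ℝ} (hι : ∀ n k, 0 < ι n k) {ε : ℕ} {l : ℝ} (hl : 0 < l)
    {A : N → K → ℝ} (hA : A ∈ lpArgmin ι ε l) {B φ : N → K → ℝ} (hB : RBFeasible ε B)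
    (hφ : ∀ n k, 0 ≤ φ n k) (hdom : ∀ n k, B n k = 0 → φ n k = 0)
    (hpow : ∑ n, ∑ k, energyTerm (ι n k) (B n k) (φ n k) ≤ slotPower ι A l) :
    ∑ n, ∑ k, φ n k ≤ slotRate ι A l := by
  have h := lagrangian_le hι hl hA hB hφ hdom
  have h2 : 0 < Real.log 2 * l := mul_pos (Real.log_pos one_lt_two) hl
  exact le_of_mul_le_mul_left (by linarith) h2

/-! ### Compactness, convexity and closed graph of the linear program -/

theorem isCompact_setOf_RBFeasible (ε : ℕ) :
    IsCompact {A : N → K → ℝ | RBFeasible ε A} := by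
  have hbox : IsCompact (Set.pi Set.univ fun _ : N => Set.pi Set.univ fun _ : K =>
      Set.Icc (0 : ℝ) 1) :=
    isCompact_univ_pi fun _ => isCompact_univ_pi fun _ => isCompact_Icc
  have heq : {A : N → K → ℝ | RBFeasible ε A} =
      ((⋂ n, {A | ∑ k, A n k ≤ (ε : ℝ)}) ∩ ⋂ k, {A | ∑ n, A n k ≤ 1}) ∩
        Set.pi Set.univ fun _ : N => Set.pi Set.univ fun _ : K => Set.Icc (0 : ℝ) 1 := by
    ext A
    simp only [Set.mem_ofPred_eq, Set.mem_inter_iff, Set.mem_iInter, Set.mem_univ_pi]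
    exact ⟨fun h => ⟨⟨h.load, h.single⟩, h.mem_Icc⟩, fun h => ⟨h.1.1, h.1.2, h.2⟩⟩
  rw [heq]
  exact hbox.inter_left
    ((isClosed_iInter fun n => isClosed_le (by fun_prop) (by fun_prop)).inter
      (isClosed_iInter fun k => isClosed_le (by fun_prop) (by fun_prop)))

theorem rbFeasible_zero (ε : ℕ) : RBFeasible ε (0 : N → K → ℝ) :=
  ⟨by simp, by simp, by simp⟩

theorem convex_setOf_RBFeasible (ε : ℕ) : Convex ℝ {A : N → K → ℝ | RBFeasible ε A} := by
  intro A hA B hB a b ha hb hab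
  refine ⟨fun n => ?_, fun k => ?_, fun n k => ?_⟩
  · simp only [Pi.add_apply, Pi.smul_apply, Finset.sum_add_distrib, ← Finset.smul_sum]
    exact (convex_Iic (ε : ℝ)) (hA.load n) (hB.load n) ha hb hab
  · simp only [Pi.add_apply, Pi.smul_apply, Finset.sum_add_distrib, ← Finset.smul_sum]
    exact (convex_Iic (1 : ℝ)) (hA.single k) (hB.single k) ha hb hab
  · exact (convex_Icc (0 : ℝ) 1) (hA.mem_Icc n k) (hB.mem_Icc n k) ha hb hab

theorem sum_mul_combo (c A B : N → K → ℝ) (a b : ℝ) :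
    ∑ n, ∑ k, c n k * (a • A + b • B) n k =
      a * ∑ n, ∑ k, c n k * A n k + b * ∑ n, ∑ k, c n k * B n k := by
  simp only [Pi.add_apply, Pi.smul_apply, smul_eq_mul, Finset.mul_sum, ← Finset.sum_add_distrib]
  refine Finset.sum_congr rfl fun n _ => Finset.sum_congr rfl fun k _ => ?_
  ring

theorem slotPower_combo (ι A B : N → K → ℝ) (a b l : ℝ) :
    slotPower ι (a • A + b • B) l = a * slotPower ι A l + b * slotPower ι B l := by
  have h := sum_mul_combo (fun n k => wfPower (ι n k) l) A B a b
  simpa only [slotPower, mul_comm] using h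

theorem convex_lpArgmin (ι : N → K → ℝ) (ε : ℕ) (l : ℝ) : Convex ℝ (lpArgmin ι ε l) := by
  intro A hA B hB a b ha hb hab
  refine ⟨convex_setOf_RBFeasible ε hA.1 hB.1 ha hb hab, fun D hD => ?_⟩
  rw [sum_mul_combo]
  exact (convex_Iic (∑ n, ∑ k, weight (ι n k) l * D n k)) (hA.2 D hD) (hB.2 D hD) ha hb hab

theorem lpArgmin_nonempty (ι : N → K → ℝ) (ε : ℕ) (l : ℝ) : (lpArgmin ι ε l).Nonempty := by
  obtain ⟨A, hA, hmin⟩ := (isCompact_setOf_RBFeasible (N := N) (K := K) ε).exists_isMinOn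
    ⟨0, rbFeasible_zero ε⟩
    (f := fun A => ∑ n, ∑ k, weight (ι n k) l * A n k) (by fun_prop)
  exact ⟨A, hA, fun B hB => hmin hB⟩

theorem continuous_wfPower (ι : ℝ) : Continuous (wfPower ι) := by
  unfold wfPower
  fun_prop

theorem continuous_wfRate_comp {X : Type*} [TopologicalSpace X] (ι : ℝ) {L : X → ℝ}
    (hL : Continuous L) (hpos : ∀ x, 0 < L x) : Continuous fun x => wfRate ι (L x) := by
  unfold wfRate Real.logb
  have := hL.log fun x => (hpos x).ne'
  fun_prop

theorem continuous_weight_comp {X : Type*} [TopologicalSpace X] (ι : ℝ) {L : X → ℝ}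
    (hL : Continuous L) (hpos : ∀ x, 0 < L x) : Continuous fun x => weight ι (L x) := by
  unfold weight
  exact ((continuous_wfPower ι).comp hL).sub
    ((continuous_const.mul hL).mul (continuous_wfRate_comp ι hL hpos))

theorem continuous_slotPower_comp {X : Type*} [TopologicalSpace X] (ι : N → K → ℝ) {L : X → ℝ}
    (hL : Continuous L) {A : X → N → K → ℝ} (hA : Continuous A) :
    Continuous fun x => slotPower ι (A x) (L x) := by
  unfold slotPower
  refine continuous_finsetSum _ fun n _ => continuous_finsetSum _ fun k _ => ?_
  exact (by fun_prop : Continuous fun x => A x n k).mul ((continuous_wfPower _).comp hL)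

theorem continuous_slotRate_comp {X : Type*} [TopologicalSpace X] (ι : N → K → ℝ) {L : X → ℝ}
    (hL : Continuous L) (hpos : ∀ x, 0 < L x) {A : X → N → K → ℝ} (hA : Continuous A) :
    Continuous fun x => slotRate ι (A x) (L x) := by
  unfold slotRate
  refine continuous_finsetSum _ fun n _ => continuous_finsetSum _ fun k _ => ?_
  exact (by fun_prop : Continuous fun x => A x n k).mul (continuous_wfRate_comp _ hL hpos)

/-- Minimality is an intersection, over feasible competitors, of closed inequalities. Positivity of
`L` keeps the logarithm continuous, which is why levels are later written `exp s`. -/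
theorem isClosed_setOf_mem_lpArgmin {X : Type*} [TopologicalSpace X] (ι : N → K → ℝ) (ε : ℕ)
    {L : X → ℝ} (hL : Continuous L) (hpos : ∀ x, 0 < L x) {A : X → N → K → ℝ}
    (hA : Continuous A) : IsClosed {x | A x ∈ lpArgmin ι ε (L x)} := by
  have heq : {x | A x ∈ lpArgmin ι ε (L x)} = (A ⁻¹' {B | RBFeasible ε B}) ∩
      ⋂ B : N → K → ℝ, ⋂ _ : RBFeasible ε B, {x | ∑ n, ∑ k, weight (ι n k) (L x) * A x n k ≤
        ∑ n, ∑ k, weight (ι n k) (L x) * B n k} := by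
    ext x
    simp only [lpArgmin, Set.mem_ofPred_eq, Set.mem_inter_iff, Set.mem_iInter, Set.mem_preimage]
  rw [heq]
  refine ((isCompact_setOf_RBFeasible ε).isClosed.preimage hA).inter
    (isClosed_iInter fun B => isClosed_iInter fun _ => isClosed_le ?_ ?_)
  all_goals
    refine continuous_finsetSum _ fun n _ => continuous_finsetSum _ fun k _ => ?_
  · exact (continuous_weight_comp _ hL hpos).mul (by fun_prop)
  · exact (continuous_weight_comp _ hL hpos).mul (by fun_prop)

/-! ### Existence of the caps -/

theorem slotPower_of_le {ι : N → K → ℝ} {l : ℝ} (h : ∀ n k, l ≤ ι n k) (A : N → K → ℝ) :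
    slotPower ι A l = 0 := by
  simp [slotPower, wfPower_of_le (h _ _)]

theorem slotRate_of_le {ι : N → K → ℝ} {l : ℝ} (hl : 0 < l) (h : ∀ n k, l ≤ ι n k)
    (A : N → K → ℝ) : slotRate ι A l = 0 := by
  simp [slotRate, wfRate_of_le hl (h _ _)]

/-- Above all floors, a solution of the linear program allocates at least one resource block. -/
theorem one_le_sum_of_mem_lpArgmin [Nonempty N] [Nonempty K] {ι : N → K → ℝ}
    (hι : ∀ n k, 0 < ι n k) {ε : ℕ} (hε : 1 ≤ ε) {l : ℝ} (hl : ∀ n k, ι n k < l)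
    {A : N → K → ℝ} (hA : A ∈ lpArgmin ι ε l) : 1 ≤ ∑ n, ∑ k, A n k := by
  classical
  by_contra! hlt
  obtain ⟨n₀⟩ := ‹Nonempty N›
  obtain ⟨k₀⟩ := ‹Nonempty K›
  -- Putting the missing mass `d` on any one block brings the total to `1`, so every row sum, column
  -- sum and entry is at most `1 ≤ ε`. The negative weight makes this a strict improvement.
  set d : ℝ := 1 - ∑ n, ∑ k, A n k with hd
  have hdpos : 0 < d := by linarith
  let D : N → K → ℝ := Pi.single n₀ (Pi.single k₀ 1)
  have hDval : ∀ n k, D n k = if n = n₀ then (if k = k₀ then 1 else 0) else 0 := by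
    intro n k
    by_cases hn : n = n₀
    · subst hn
      simp [D, Pi.single_apply]
    · simp [D, hn]
  have hD0 : ∀ n k, 0 ≤ D n k := fun n k => by rw [hDval]; split_ifs <;> norm_num
  have hsum : ∀ c : N → K → ℝ, ∑ n, ∑ k, c n k * D n k = c n₀ k₀ := by
    intro c
    rw [Finset.sum_eq_single n₀ (fun n _ hn => by simp [hDval, hn]) (by simp)]
    simp [hDval]
  let B : N → K → ℝ := (1 : ℝ) • A + d • D
  have hBsum : ∑ n, ∑ k, B n k = 1 := by
    have h := sum_mul_combo (fun _ _ => 1) A D 1 d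
    rw [hsum] at h
    simp only [one_mul] at h
    rw [h]
    ring
  have hB0 : ∀ n k, 0 ≤ B n k := fun n k => by
    have h₁ := (hA.1.mem_Icc n k).1
    have h₂ := mul_nonneg hdpos.le (hD0 n k)
    simp only [B, Pi.add_apply, Pi.smul_apply, smul_eq_mul]
    linarith
  have hrow : ∀ n, ∑ k, B n k ≤ 1 := fun n => hBsum ▸
    Finset.single_le_sum (f := fun n => ∑ k, B n k)
      (fun n _ => Finset.sum_nonneg fun k _ => hB0 n k) (Finset.mem_univ n)
  have hB : RBFeasible ε B := by
    refine ⟨fun n => (hrow n).trans (by exact_mod_cast hε), fun k => ?_, fun n k => ⟨hB0 n k, ?_⟩⟩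
    · rw [Finset.sum_comm] at hBsum
      exact hBsum ▸ Finset.single_le_sum (f := fun k => ∑ n, B n k)
        (fun k _ => Finset.sum_nonneg fun n _ => hB0 n k) (Finset.mem_univ k)
    · exact (Finset.single_le_sum (f := fun k => B n k)
        (fun k _ => hB0 n k) (Finset.mem_univ k)).trans (hrow n)
  have h := hA.2 B hB
  rw [sum_mul_combo (fun n k => weight (ι n k) l), hsum] at h
  have := mul_neg_of_pos_of_neg hdpos (weight_neg (hι n₀ k₀) (hl n₀ k₀))
  linarith

/-- The allocation has mass at least `1`, and each unit of it draws power at least `p`. -/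
theorem le_slotPower [Nonempty N] [Nonempty K] {ι : N → K → ℝ}
    (hι : ∀ n k, 0 < ι n k) {ε : ℕ} (hε : 1 ≤ ε) {l p : ℝ} (hp : 0 < p)
    (hl : ∀ n k, ι n k + p ≤ l) {A : N → K → ℝ} (hA : A ∈ lpArgmin ι ε l) :
    p ≤ slotPower ι A l := by
  have h1 := one_le_sum_of_mem_lpArgmin hι hε (fun n k => by linarith [hl n k]) hA
  calc p ≤ (∑ n, ∑ k, A n k) * p := le_mul_of_one_le_left hp.le h1
    _ = ∑ n, ∑ k, A n k * p := by simp only [Finset.sum_mul]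
    _ ≤ slotPower ι A l := Finset.sum_le_sum fun n _ => Finset.sum_le_sum fun k _ =>
      mul_le_mul_of_nonneg_left ((le_sub_iff_add_le'.2 (hl n k)).trans (le_max_right _ _))
        (hA.1.mem_Icc n k).1

/-- The power equation of a slot has a solution. -/
theorem exists_cap [Nonempty N] [Nonempty K] {ι : N → K → ℝ}
    (hι : ∀ n k, 0 < ι n k) {ε : ℕ} (hε : 1 ≤ ε) {p : ℝ} (hp : 0 < p) {lo hi : ℝ}
    (hlo : ∀ n k, Real.exp lo ≤ ι n k) (hhi : ∀ n k, ι n k + p ≤ Real.exp hi) :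
    ∃ s ∈ Set.Icc lo hi, ∃ A ∈ lpArgmin ι ε (Real.exp s), slotPower ι A (Real.exp s) = p := by
  have hlh : lo ≤ hi := by
    obtain ⟨n₀⟩ := ‹Nonempty N›
    obtain ⟨k₀⟩ := ‹Nonempty K›
    exact Real.exp_le_exp.1 (by linarith [hlo n₀ k₀, hhi n₀ k₀])
  obtain ⟨A₀, hA₀⟩ := lpArgmin_nonempty ι ε (Real.exp lo)
  obtain ⟨A₁, hA₁⟩ := lpArgmin_nonempty ι ε (Real.exp hi)
  have hL : Continuous fun q : ℝ × (N → K → ℝ) => Real.exp q.1 := by fun_prop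
  exact exists_mem_graph_eq
    (G := {q : ℝ × (N → K → ℝ) | q.2 ∈ lpArgmin ι ε (Real.exp q.1)})
    (isClosed_setOf_mem_lpArgmin ι ε hL (fun _ => Real.exp_pos _) continuous_snd)
    (isCompact_setOf_RBFeasible ε) (fun _ _ h => h.1)
    (fun s => convex_lpArgmin ι ε (Real.exp s)) hlh
    (fun s _ => lpArgmin_nonempty ι ε (Real.exp s))
    (continuous_slotPower_comp ι hL continuous_snd) p
    ⟨A₀, hA₀, (slotPower_of_le hlo A₀).trans_le hp.le⟩
    ⟨A₁, hA₁, le_slotPower hι hε hp hhi hA₁⟩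

/-! ### Coupling the slots through the global level -/

/-- The graph of the per-slot allocations which solve the linear program at the level
`min (exp s) (cap t)`, respect the power budget and exhaust it above the cap. -/
def cappedGraph (ι : T → N → K → ℝ) (ε : ℕ) (p : ℝ) (cap : T → ℝ) :
    Set (ℝ × (T → N → K → ℝ)) :=
  {q | ∀ t, q.2 t ∈ lpArgmin (ι t) ε (min (Real.exp q.1) (cap t)) ∧
    slotPower (ι t) (q.2 t) (min (Real.exp q.1) (cap t)) ≤ p ∧
    (Real.exp q.1 - cap t) * (p - slotPower (ι t) (q.2 t) (min (Real.exp q.1) (cap t))) ≤ 0}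

/-- The product inequality encodes "above the cap, the budget is spent" as a closed condition: given
power at most `p`, it is automatic up to the cap and forces equality above it. -/
theorem isClosed_cappedGraph (ι : T → N → K → ℝ) (ε : ℕ) (p : ℝ) {cap : T → ℝ}
    (hcap : ∀ t, 0 < cap t) : IsClosed (cappedGraph ι ε p cap) := by
  simp only [cappedGraph, Set.ofPred_forall, Set.ofPred_and]
  refine isClosed_iInter fun t => ?_
  have hL : Continuous fun q : ℝ × (T → N → K → ℝ) => min (Real.exp q.1) (cap t) := by fun_prop
  have hA : Continuous fun q : ℝ × (T → N → K → ℝ) => q.2 t := by fun_prop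
  have hP := continuous_slotPower_comp (ι t) hL hA
  refine (isClosed_setOf_mem_lpArgmin (ι t) ε hL
    (fun q => lt_min (Real.exp_pos _) (hcap t)) hA).inter
    ((isClosed_le hP continuous_const).inter (isClosed_le ?_ continuous_const))
  exact (by fun_prop : Continuous fun q : ℝ × (T → N → K → ℝ) => Real.exp q.1 - cap t).mul
    (continuous_const.sub hP)

/-- At a fixed level the slot power is linear in the allocation, so the budget and product
conditions are affine inequalities. -/
theorem convex_cappedGraph (ι : T → N → K → ℝ) (ε : ℕ) (p : ℝ) (cap : T → ℝ) (s : ℝ) :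
    Convex ℝ {a | (s, a) ∈ cappedGraph ι ε p cap} := by
  intro A hA B hB a b ha hb hab t
  obtain ⟨hA₁, hA₂, hA₃⟩ := hA t
  obtain ⟨hB₁, hB₂, hB₃⟩ := hB t
  refine ⟨convex_lpArgmin _ _ _ hA₁ hB₁ ha hb hab, ?_, ?_⟩
  · exact (slotPower_combo (ι t) (A t) (B t) a b _).trans_le
      (convex_Iic p (Set.mem_Iic.2 hA₂) (Set.mem_Iic.2 hB₂) ha hb hab)
  · have h := convex_Iic (0 : ℝ) (Set.mem_Iic.2 hA₃) (Set.mem_Iic.2 hB₃) ha hb hab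
    refine le_of_eq_of_le ?_ (Set.mem_Iic.1 h)
    have hP := slotPower_combo (ι t) (A t) (B t) a b (min (Real.exp s) (cap t))
    simp only [Pi.add_apply, Pi.smul_apply, smul_eq_mul] at hP ⊢
    rw [hP]
    linear_combination (-(Real.exp s - cap t) * p) * hab

/-- Below the cap, monotonicity of the power keeps every minimizer within budget; from the cap on,
`acap` serves. -/
theorem cappedGraph_nonempty {ι : T → N → K → ℝ} (hι : ∀ t n k, 0 < ι t n k) {ε : ℕ} {p : ℝ}
    {cap : T → ℝ} {acap : T → N → K → ℝ}
    (hacap : ∀ t, acap t ∈ lpArgmin (ι t) ε (cap t))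
    (hpow : ∀ t, slotPower (ι t) (acap t) (cap t) = p) (s : ℝ) :
    ∃ a, (s, a) ∈ cappedGraph ι ε p cap := by
  have : ∀ t, ∃ A, A ∈ lpArgmin (ι t) ε (min (Real.exp s) (cap t)) ∧
      slotPower (ι t) A (min (Real.exp s) (cap t)) ≤ p ∧
      (Real.exp s - cap t) * (p - slotPower (ι t) A (min (Real.exp s) (cap t))) ≤ 0 := by
    intro t
    rcases lt_or_ge (Real.exp s) (cap t) with h | h
    · obtain ⟨A, hA⟩ := lpArgmin_nonempty (ι t) ε (Real.exp s)
      have hm := slotPower_mono (hι t) (Real.exp_pos s) h hA (hacap t)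
      rw [hpow t] at hm
      rw [min_eq_left h.le]
      exact ⟨A, hA, hm, mul_nonpos_of_nonpos_of_nonneg (by linarith) (by linarith)⟩
    · rw [min_eq_right h]
      exact ⟨acap t, hacap t, (hpow t).le, by simp [hpow t]⟩
  choose a ha using this
  exact ⟨a, ha⟩

theorem slotPower_eq_of_mem_cappedGraph {ι : T → N → K → ℝ} {ε : ℕ} {p s : ℝ} {cap : T → ℝ}
    {a : T → N → K → ℝ} (ha : (s, a) ∈ cappedGraph ι ε p cap) {t : T}
    (ht : cap t < Real.exp s) : slotPower (ι t) (a t) (min (Real.exp s) (cap t)) = p :=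
  le_antisymm (ha t).2.1 <| by
    have := nonpos_of_mul_nonpos_right (ha t).2.2 (sub_pos.2 ht)
    exact sub_nonpos.1 this

variable [Fintype T]

/-- The rate equation has a solution, once every slot has a cap. -/
theorem exists_level {ι : T → N → K → ℝ} (hι : ∀ t n k, 0 < ι t n k) {ε : ℕ} {p υ : ℝ}
    (hυ : 0 < υ) {a' φ' : T → N → K → ℝ} (hfeas : Feasible ι p υ ε a' φ') {lo hi : ℝ}
    (hlh : lo ≤ hi) (hlo : ∀ t n k, Real.exp lo ≤ ι t n k) {cap : T → ℝ}
    (hcap : ∀ t, 0 < cap t) (hlocap : ∀ t, Real.exp lo ≤ cap t)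
    (hcaphi : ∀ t, cap t < Real.exp hi) {acap : T → N → K → ℝ}
    (hacap : ∀ t, acap t ∈ lpArgmin (ι t) ε (cap t))
    (hpow : ∀ t, slotPower (ι t) (acap t) (cap t) = p) :
    ∃ s a, (s, a) ∈ cappedGraph ι ε p cap ∧
      ∑ t, slotRate (ι t) (a t) (min (Real.exp s) (cap t)) = υ := by
  obtain ⟨a₀, ha₀⟩ := cappedGraph_nonempty hι hacap hpow lo
  obtain ⟨a₁, ha₁⟩ := cappedGraph_nonempty hι hacap hpow hi
  obtain ⟨s, -, a, ha, h⟩ := exists_mem_graph_eq (isClosed_cappedGraph ι ε p hcap)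
    (isCompact_univ_pi fun _ : T => isCompact_setOf_RBFeasible (N := N) (K := K) ε)
    (fun s a h t _ => (h t).1.1) (convex_cappedGraph ι ε p cap) hlh
    (fun s _ => cappedGraph_nonempty hι hacap hpow s)
    (h := fun q => ∑ t, slotRate (ι t) (q.2 t) (min (Real.exp q.1) (cap t)))
    (continuous_finsetSum _ fun t _ => continuous_slotRate_comp (ι t)
      (by fun_prop) (fun q => lt_min (Real.exp_pos _) (hcap t)) (by fun_prop)) υ
    ⟨a₀, ha₀, by
      simp only [min_eq_left (hlocap _), slotRate_of_le (Real.exp_pos lo) (hlo _)]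
      simpa using hυ.le⟩
    -- At `hi` every slot is above its cap and spends its budget, so slot by slot its rate is at
    -- least that of the feasible point.
    ⟨a₁, ha₁, hfeas.rate.trans <| Finset.sum_le_sum fun t _ =>
      rate_le_slotRate (hι t) (lt_min (Real.exp_pos _) (hcap t)) (ha₁ t).1 (hfeas.alloc t)
        (hfeas.nonneg t) (hfeas.dom t)
        ((hfeas.power t).trans_eq (slotPower_eq_of_mem_cappedGraph ha₁ (hcaphi t)).symm)⟩
  exact ⟨s, a, ha, h⟩

/-! ### Optimality by weak duality -/

theorem isOptimal_of_mem_cappedGraph {ι : T → N → K → ℝ} (hι : ∀ t n k, 0 < ι t n k) {ε : ℕ}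
    {p υ s : ℝ} {cap : T → ℝ} (hcap : ∀ t, 0 < cap t) {a : T → N → K → ℝ}
    (ha : (s, a) ∈ cappedGraph ι ε p cap)
    (hrate : ∑ t, slotRate (ι t) (a t) (min (Real.exp s) (cap t)) = υ) :
    IsOptimal ι p υ ε a
      fun t n k => a t n k * wfRate (ι t n k) (min (Real.exp s) (cap t)) := by
  have hpos : ∀ t, 0 < min (Real.exp s) (cap t) := fun t => lt_min (Real.exp_pos _) (hcap t)
  have hpow := fun t => sum_energyTerm_wfRate (hι t) (hpos t) (a t)
  refine ⟨⟨hrate.ge, fun t n k => mul_nonneg ((ha t).1.1.mem_Icc n k).1 (wfRate_nonneg _ _),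
    fun t => (hpow t).trans_le (ha t).2.1, fun t => (ha t).1.1,
    fun t n k h => by simp [h]⟩, fun a' φ' hf => ?_⟩
  have h2 : 0 < Real.log 2 := Real.log_pos one_lt_two
  -- The rate price is `ln 2 · exp s` in every slot. In a capped slot the Lagrangian bound holds
  -- only at the price of `cap t`; the price difference is covered by maximality of the slot rate.
  have hslot : ∀ t, slotPower (ι t) (a t) (min (Real.exp s) (cap t)) -
      Real.log 2 * Real.exp s * slotRate (ι t) (a t) (min (Real.exp s) (cap t)) ≤
      ∑ n, ∑ k, energyTerm (ι t n k) (a' t n k) (φ' t n k) -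
        Real.log 2 * Real.exp s * ∑ n, ∑ k, φ' t n k := by
    intro t
    have hlag := lagrangian_le (hι t) (hpos t) (ha t).1 (hf.alloc t) (hf.nonneg t) (hf.dom t)
    rcases le_or_gt (Real.exp s) (cap t) with h | h
    · rwa [min_eq_left h] at hlag ⊢
    · have hr := rate_le_slotRate (hι t) (hpos t) (ha t).1 (hf.alloc t) (hf.nonneg t) (hf.dom t)
        ((hf.power t).trans_eq (slotPower_eq_of_mem_cappedGraph ha h).symm)
      rw [min_eq_right h.le] at hlag hr ⊢
      have := mul_le_mul_of_nonneg_left hr (mul_pos h2 (sub_pos.2 h)).le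
      linarith
  have hsum := Finset.sum_le_sum fun t (_ : t ∈ Finset.univ) => hslot t
  simp only [Finset.sum_sub_distrib, ← Finset.mul_sum, hrate] at hsum
  have hυ := mul_le_mul_of_nonneg_left hf.rate (mul_pos h2 (Real.exp_pos s)).le
  simp only [energy, hpow]
  linarith

/-! ### Choice of the levels and conclusion -/

theorem txPower_wfRate {ι l a : ℝ} (hι : 0 < ι) (hl : 0 < l) (ha : 0 < a) :
    txPower ι a (a * wfRate ι l) = wfPower ι l := by
  rw [txPower, if_pos ha, mul_div_cancel_left₀ _ ha.ne', mul_two_rpow_wfRate_sub_one hι hl]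

/-- Finitely many positive reals lie above a common exponential. -/
theorem exists_exp_le {α : Type*} [Finite α] (f : α → ℝ) (hf : ∀ x, 0 < f x) :
    ∃ s, ∀ x, Real.exp s ≤ f x := by
  obtain ⟨s, hs⟩ := (Set.finite_range fun x => Real.log (f x)).bddBelow
  exact ⟨s, fun x => (Real.le_log_iff_exp_le (hf x)).1 (hs ⟨x, rfl⟩)⟩

/-- Finitely many reals lie below a common exponential. -/
theorem exists_le_exp {α : Type*} [Finite α] (f : α → ℝ) : ∃ s, ∀ x, f x ≤ Real.exp s := by
  obtain ⟨s, hs⟩ := (Set.finite_range f).bddAbove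
  exact ⟨s, fun x => (hs ⟨x, rfl⟩).trans (by linarith [Real.add_one_le_exp s])⟩

end RBAlloc

theorem proposition2 {N K T : Type*} [Fintype N] [Fintype K] [Fintype T]
    (δsq : ℝ) (g κ ι : T → N → K → ℝ) (pbar υbar : ℝ) (ε : ℕ)
    (hδ : 0 < δsq) (hg : ∀ t n k, 0 < g t n k) (hκ : ∀ t n k, 0 < κ t n k)
    (hι : ∀ t n k, ι t n k = RBAlloc.iota δsq (g t n k) (κ t n k))
    (hp : 0 < pbar) (hυ : 0 < υbar) (hε : 1 ≤ ε)
    (hfeas : ∃ a φ : T → N → K → ℝ, RBAlloc.Feasible ι pbar υbar ε a φ) :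
    ∃ a φ : T → N → K → ℝ, RBAlloc.IsOptimal ι pbar υbar ε a φ ∧
      ∃ (lstar : ℝ) (cap : T → ℝ) (acap : T → N → K → ℝ),
        0 < lstar ∧
        -- the allocation solves the per-slot linear program at the effective level
        (∀ t, a t ∈ RBAlloc.lpArgmin (ι t) ε (RBAlloc.level lstar (cap t))) ∧
        -- water-filling rate and power
        (∀ t n k, φ t n k = a t n k * RBAlloc.wfRate (ι t n k) (RBAlloc.level lstar (cap t))) ∧
        (∀ t n k, 0 < a t n k → RBAlloc.txPower (ι t n k) (a t n k) (φ t n k) =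
          RBAlloc.wfPower (ι t n k) (RBAlloc.level lstar (cap t))) ∧
        -- the cap of each slot solves the power equation
        (∀ t, acap t ∈ RBAlloc.lpArgmin (ι t) ε (cap t) ∧
          RBAlloc.slotPower (ι t) (acap t) (cap t) = pbar ∧
          (cap t < lstar / Real.log 2 → acap t = a t)) ∧
        -- the global level solves the rate equation
        ∑ t, RBAlloc.slotRate (ι t) (a t) (RBAlloc.level lstar (cap t)) = υbar := by
  have hιpos : ∀ t n k, 0 < ι t n k := fun t n k => by
    rw [hι]
    exact RBAlloc.iota_pos hδ (hg t n k) (hκ t n k)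
  obtain ⟨a', φ', hf⟩ := hfeas
  -- A positive rate cannot be met by an empty sum.
  have hT : Nonempty T := by
    by_contra h
    rw [not_nonempty_iff] at h
    simpa using hυ.trans_le hf.rate
  have hN : Nonempty N := by
    by_contra h
    rw [not_nonempty_iff] at h
    simpa using hυ.trans_le hf.rate
  have hK : Nonempty K := by
    by_contra h
    rw [not_nonempty_iff] at h
    simpa using hυ.trans_le hf.rate
  obtain ⟨lo, hlo⟩ := RBAlloc.exists_exp_le (fun x : T × N × K => ι x.1 x.2.1 x.2.2)
    fun x => hιpos _ _ _
  obtain ⟨hi, hhi⟩ := RBAlloc.exists_le_exp fun x : T × N × K => ι x.1 x.2.1 x.2.2 + pbar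
  choose s hs acap hacap hpow using fun t => RBAlloc.exists_cap (hιpos t) hε hp
    (fun n k => hlo (t, n, k)) (fun n k => hhi (t, n, k))
  -- The extra `1` puts the upper level strictly above all caps, which may equal `exp hi`.
  have hlh : lo ≤ hi + 1 := by
    obtain ⟨t⟩ := hT
    linarith [(hs t).1, (hs t).2]
  obtain ⟨σ, a, ha, hrate⟩ := RBAlloc.exists_level hιpos hυ hf hlh
    (fun t n k => hlo (t, n, k)) (cap := fun t => Real.exp (s t)) (fun t => Real.exp_pos _)
    (fun t => Real.exp_le_exp.2 (hs t).1)
    (fun t => Real.exp_lt_exp.2 (by linarith [(hs t).2])) hacap hpow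
  have h2 : 0 < Real.log 2 := Real.log_pos one_lt_two
  have hdiv : Real.exp σ * Real.log 2 / Real.log 2 = Real.exp σ := mul_div_cancel_right₀ _ h2.ne'
  classical
  refine ⟨a, _, RBAlloc.isOptimal_of_mem_cappedGraph hιpos (fun t => Real.exp_pos _) ha hrate,
    Real.exp σ * Real.log 2, fun t => Real.exp (s t),
    -- Where the cap binds strictly, `a t` itself solves the power equation at the cap and replaces
    -- the earlier witness.
    fun t => if Real.exp (s t) < Real.exp σ then a t else acap t, by positivity, ?_⟩
  simp only [RBAlloc.level, hdiv]
  refine ⟨fun t => (ha t).1, fun _ _ _ => trivial, fun t n k hpos =>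
    RBAlloc.txPower_wfRate (hιpos t n k) (lt_min (Real.exp_pos _) (Real.exp_pos _)) hpos,
    fun t => ?_, hrate⟩
  by_cases h : Real.exp (s t) < Real.exp σ
  · have h₁ := (ha t).1
    have h₂ := RBAlloc.slotPower_eq_of_mem_cappedGraph ha h
    rw [min_eq_right h.le] at h₁ h₂
    simp only [if_pos h]
    exact ⟨h₁, h₂, fun _ => trivial⟩
  · simp only [if_neg h]
    exact ⟨hacap t, hpow t, fun h' => absurd h' h⟩
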